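/- Let $V:\mathbb R\to\mathbb R$ be real analytic with $V(x)/\log(1+|x|)\to+\infty$ as $x\to\pm\infty$, and let $\mu_0$ be the equilibrium measure in the external field $V$, i.e. the Borel probability measure on $\mathbb R$ that minimizes the logarithmic energy $$\iint \log\frac1{|s-t|}\,d\mu(s)\,d\mu(t)+\int V(t)\,d\mu(t)$$ among all Borel probability measures on $\mathbb R$ (the energy being understood in $(-\infty,+\infty]$ as $\iint\big(\log\frac1{|s-t|}+\tfrac12V(s)+\tfrac12V(t)\big)d\mu(s)d\mu(t)$). Let $k\ge1$ be an integer and let $x^*\in\operatorname{supp}\mu_0$. Suppose that in a neighbourhood of $x^*$ the measure $\mu_0$ has a density $\psi_0$ such that, for some $c_0>0$ and some function $h$ that is real analytic at $x^*$ with $h(x^*)=1$, one of the following holds for $s$ near $x^*$: (a) ($x^*$ is a singular interior point with exponent $2k$) $x^*$ is an interior point of $\operatorname{supp}\mu_0$ and $\psi_0(s)=c_0^{2k+1}(s-x^*)^{2k}h(s)$; (b) ($x^*$ is a singular right edge point with exponent $2k+\frac12$) $\psi_0(s)=c_0^{2k+3/2}(x^*-s)^{2k+1/2}h(s)$ for $s\le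 x^*$ and $\psi_0(s)=0$ for $s>x^*$; (b$'$) ($x^*$ is a singular left edge point with exponent $2k+\frac12$) $\psi_0(s)=c_0^{2k+3/2}(s-x^*)^{2k+1/2}h(s)$ for $s\ge x^*$ and $\psi_0(s)=0$ for $s<x^*$. Then for every $l=1,2,\dots,2k$ the function $s\mapsto (s-x^*)^{-l}$ is $\mu_0$-integrable and $$V^{(l)}(x^*)=-2\,(l-1)!\int\frac{d\mu_0(s)}{(s-x^*)^l}.$$ In particular, with $\tau_{\mathrm{crit}}:=\Big[\int\frac{d\mu_0(s)}{(x^*-s)^2}\Big]^{-1}$ and $x^*_\tau:=x^*+\tau\int\frac{d\mu_0(s)}{x^*-s}$, one has $\tau_{\mathrm{crit}}>0$, $V''(x^*)<0$, $$\tau_{\mathrm{crit}}=-\frac{2}{V''(x^*)},\qquad x^*_\tau=x^*+\frac{\tau}{2}V'(x^*)\quad\text{for all }\tau\in\mathbb R.$$ -/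

import Mathlib

open MeasureTheory Filter Topology

noncomputable section

namespace ExternalField

/-- An admissible external field: real analytic on the line, and growing faster than the logarithm
at both ends, `V(x) / log(1+|x|) → +∞` as `x → ±∞`. -/
structure IsAdmissible (V : ℝ → ℝ) : Prop where
  analytic : AnalyticOnNhd ℝ V Set.univ
  growth_atTop : Tendsto (fun x : ℝ => V x / Real.log (1 + |x|)) atTop atTop
  growth_atBot : Tendsto (fun x : ℝ => V x / Real.log (1 + |x|)) atBot atTop

/-- The symmetric energy kernel `log (1/|s-t|) + (V(s) + V(t))/2`, equal to `+∞` for `s = t`. -/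
def kernel (V : ℝ → ℝ) (s t : ℝ) : EReal :=
  -ENNReal.log (edist s t) + (((V s + V t) / 2 : ℝ) : EReal)

/-- The logarithmic energy `∬ log (1/|s-t|) dμ(s) dμ(t) + ∫ V dμ` in the external field `V`, with
values in `(-∞, +∞]`. The two terms are put under one double integral (`μ` has mass one), so that
the energy is defined for every probability measure: the kernel is bounded below for an admissible
field, hence the integral of its negative part is finite, while the two terms taken separately
could be `-∞` and `+∞`. -/
def energy (V : ℝ → ℝ) (μ : Measure ℝ) : EReal :=
  ((∫⁻ p : ℝ × ℝ, (kernel V p.1 p.2).toENNReal ∂(μ.prod μ) : ENNReal) : EReal) -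
    ((∫⁻ p : ℝ × ℝ, (-kernel V p.1 p.2).toENNReal ∂(μ.prod μ) : ENNReal) : EReal)

/-- `μ` is the equilibrium measure in the external field `V`: it minimizes the energy among all
Borel probability measures on the line. -/
structure IsEquilibriumMeasure (V : ℝ → ℝ) (μ : Measure ℝ) : Prop where
  isProbability : IsProbabilityMeasure μ
  minimizes : ∀ ν : Measure ℝ, IsProbabilityMeasure ν → energy V μ ≤ energy V ν

/-- `μ` has density `ψ` with respect to Lebesgue measure in a neighbourhood of `x`. -/
def HasDensityNear (μ : Measure ℝ) (ψ : ℝ → ℝ) (x : ℝ) : Prop :=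
  ∃ ε : ℝ, 0 < ε ∧ μ.restrict (Set.Ioo (x - ε) (x + ε)) =
    (volume.restrict (Set.Ioo (x - ε) (x + ε))).withDensity (fun s => ENNReal.ofReal (ψ s))

/-- `x` is a singular interior point with exponent `2k` of `μ`. -/
def IsSingularInteriorPoint (μ : Measure ℝ) (k : ℕ) (x : ℝ) : Prop :=
  1 ≤ k ∧ x ∈ interior μ.support ∧
    ∃ (c₀ : ℝ) (h : ℝ → ℝ), 0 < c₀ ∧ AnalyticAt ℝ h x ∧ h x = 1 ∧
      HasDensityNear μ (fun s => c₀ ^ (2 * k + 1) * (s - x) ^ (2 * k) * h s) x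

/-- `x` is a singular right edge point with exponent `2k + 1/2` of `μ`. -/
def IsSingularRightEdgePoint (μ : Measure ℝ) (k : ℕ) (x : ℝ) : Prop :=
  1 ≤ k ∧ x ∈ μ.support ∧
    ∃ (c₀ : ℝ) (h : ℝ → ℝ), 0 < c₀ ∧ AnalyticAt ℝ h x ∧ h x = 1 ∧
      HasDensityNear μ (fun s => if s ≤ x then
        c₀ ^ (2 * (k : ℝ) + 3 / 2) * (x - s) ^ (2 * (k : ℝ) + 1 / 2) * h s else 0) x

/-- `x` is a singular left edge point with exponent `2k + 1/2` of `μ`. -/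
def IsSingularLeftEdgePoint (μ : Measure ℝ) (k : ℕ) (x : ℝ) : Prop :=
  1 ≤ k ∧ x ∈ μ.support ∧
    ∃ (c₀ : ℝ) (h : ℝ → ℝ), 0 < c₀ ∧ AnalyticAt ℝ h x ∧ h x = 1 ∧
      HasDensityNear μ (fun s => if x ≤ s then
        c₀ ^ (2 * (k : ℝ) + 3 / 2) * (s - x) ^ (2 * (k : ℝ) + 1 / 2) * h s else 0) x

/-- `x` is a singular edge point with exponent `2k + 1/2` of `μ`, right or left. -/
def IsSingularEdgePoint (μ : Measure ℝ) (k : ℕ) (x : ℝ) : Prop :=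
  IsSingularRightEdgePoint μ k x ∨ IsSingularLeftEdgePoint μ k x

/-- The critical value `τ_crit = (∫ dμ(s) / (x - s)^2)⁻¹`. -/
def tauCrit (μ : Measure ℝ) (x : ℝ) : ℝ :=
  (∫ s, 1 / (x - s) ^ 2 ∂μ)⁻¹

/-- The shifted point `x_τ = x + τ ∫ dμ(s) / (x - s)`. -/
def shiftedPoint (μ : Measure ℝ) (x τ : ℝ) : ℝ :=
  x + τ * ∫ s, 1 / (x - s) ∂μ

end ExternalField

end

/-! Perturbing `μ` to `(1 + εf) μ`, with `f` bounded of mean zero, shows that `V(s)/2 - ∫ log|s - t|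
dμ(t)` is constant for `μ`-almost every `s` (`IsEquilibriumMeasure.eulerLagrange`). Differentiating
this at `x` formally gives the formula, but the equation is known only almost everywhere and the
kernel is singular, so finite expansions are compared instead.

With `n = 2k`, each type of singular point has density at most `C|s - x|^n` nearby (`DensityBound`).
Hence the moments `∫ (s - x)^(-j) dμ`, `j ≤ n`, exist, and replacing `log|1 - δ/(s - x)|` by its
Taylor polynomial of degree `n` costs `o(δ^n)` after integration
(`DensityBound.eventually_integrable_and_tendsto`). Since `x` lies in the support and is not an
atom, the equation holds at points `x + δ` with `δ → 0`, `δ ≠ 0`. Along these, the Taylor expansion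
of `V` agrees up to `o(δ^n)` with a polynomial whose coefficients are the moments, so the
coefficients coincide (`coeff_eq_zero_of_isLittleO`). -/

namespace ExternalField

/-! ### Energy kernel and finiteness of the minimal energy -/

/-- The real-valued energy kernel, with a junk value on the diagonal. -/
noncomputable def realKernel (V : ℝ → ℝ) (s t : ℝ) : ℝ := -Real.log (s - t) + (V s + V t) / 2

lemma kernel_eq_realKernel (V : ℝ → ℝ) {s t : ℝ} (h : s ≠ t) :
    kernel V s t = (realKernel V s t : EReal) := by
  have h0 : 0 < |s - t| := abs_pos.2 (sub_ne_zero.2 h)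
  rw [kernel, realKernel, edist_dist, Real.dist_eq, ENNReal.log_ofReal_of_pos h0, Real.log_abs]
  push_cast
  rfl

lemma kernel_self (V : ℝ → ℝ) (s : ℝ) : kernel V s s = ⊤ := by
  simp [kernel]

lemma realKernel_comm (V : ℝ → ℝ) (s t : ℝ) : realKernel V s t = realKernel V t s := by
  rw [realKernel, realKernel, ← neg_sub t s, Real.log_neg_eq_log, add_comm (V s)]

lemma measurable_realKernel {V : ℝ → ℝ} (hV : Continuous V) :
    Measurable fun p : ℝ × ℝ => realKernel V p.1 p.2 := by
  unfold realKernel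
  have := hV.measurable
  fun_prop

lemma IsAdmissible.continuous {V : ℝ → ℝ} (hV : IsAdmissible V) : Continuous V :=
  continuousOn_univ.1 hV.analytic.continuousOn

/-- Superlogarithmic growth handles both ends, compactness the middle. The factor 2 lets `(V s + V
t)/2` absorb `log(1+|s|) + log(1+|t|)`, which dominates `log|s - t|`. -/
lemma IsAdmissible.exists_log_le {V : ℝ → ℝ} (hV : IsAdmissible V) :
    ∃ C, ∀ s, 2 * Real.log (1 + |s|) - C ≤ V s := by
  have hlog : ∀ s : ℝ, s ≠ 0 → 0 < Real.log (1 + |s|) := fun s hs =>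
    Real.log_pos (by linarith [abs_pos.2 hs])
  have h1 := (hV.growth_atTop.eventually_ge_atTop 2).and (eventually_gt_atTop 0)
  have h2 := (hV.growth_atBot.eventually_ge_atTop 2).and (eventually_lt_atBot 0)
  obtain ⟨b, hb⟩ := eventually_atTop.1 h1
  obtain ⟨a, ha⟩ := eventually_atBot.1 h2
  have hc : Continuous fun s => 2 * Real.log (1 + |s|) - V s := by
    have := hV.continuous
    refine (continuous_const.mul (Continuous.log (by fun_prop) fun s => ?_)).sub this
    positivity
  obtain ⟨C, hC⟩ := (isCompact_Icc (a := a) (b := b)).bddAbove_image hc.continuousOn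
  refine ⟨max C 0, fun s => ?_⟩
  rcases le_or_gt s a with hs | hs
  · obtain ⟨h, h'⟩ := ha s hs
    rw [le_div_iff₀ (hlog s h'.ne)] at h
    linarith [le_max_right C 0]
  rcases le_or_gt b s with hs' | hs'
  · obtain ⟨h, h'⟩ := hb s hs'
    rw [le_div_iff₀ (hlog s h'.ne')] at h
    linarith [le_max_right C 0]
  · have := hC (Set.mem_image_of_mem _ ⟨hs.le, hs'.le⟩)
    linarith [le_max_left C 0]

lemma IsAdmissible.exists_le_realKernel {V : ℝ → ℝ} (hV : IsAdmissible V) :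
    ∃ C, ∀ s t, -C ≤ realKernel V s t := by
  obtain ⟨C, hC⟩ := hV.exists_log_le
  refine ⟨|C|, fun s t => ?_⟩
  have h1 := hC s
  have h2 := hC t
  have h3 : Real.log (s - t) ≤ Real.log (1 + |s|) + Real.log (1 + |t|) := by
    rw [← Real.log_mul (by positivity) (by positivity)]
    rcases eq_or_ne s t with rfl | hst
    · simp only [sub_self, Real.log_zero]
      exact Real.log_nonneg (by nlinarith [abs_nonneg s])
    · rw [← Real.log_abs (s - t)]
      refine Real.log_le_log (abs_pos.2 (sub_ne_zero.2 hst)) ?_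
      nlinarith [abs_sub s t, abs_nonneg s, abs_nonneg t]
  rw [realKernel]
  linarith [le_abs_self C]

lemma energy_eq_integral {V : ℝ → ℝ} {ν : Measure ℝ}
    (hint : Integrable (fun p : ℝ × ℝ => realKernel V p.1 p.2) (ν.prod ν))
    (hne : ∀ᵐ p : ℝ × ℝ ∂(ν.prod ν), p.1 ≠ p.2) :
    energy V ν = ((∫ p : ℝ × ℝ, realKernel V p.1 p.2 ∂(ν.prod ν) : ℝ) : EReal) := by
  have h1 : ∫⁻ p : ℝ × ℝ, (kernel V p.1 p.2).toENNReal ∂(ν.prod ν) =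
      ∫⁻ p : ℝ × ℝ, ENNReal.ofReal (realKernel V p.1 p.2) ∂(ν.prod ν) := by
    refine lintegral_congr_ae (hne.mono fun p hp => ?_)
    simp [kernel_eq_realKernel V hp]
  have h2 : ∫⁻ p : ℝ × ℝ, (-kernel V p.1 p.2).toENNReal ∂(ν.prod ν) =
      ∫⁻ p : ℝ × ℝ, ENNReal.ofReal (-realKernel V p.1 p.2) ∂(ν.prod ν) := by
    refine lintegral_congr_ae (hne.mono fun p hp => ?_)
    simp only
    rw [kernel_eq_realKernel V hp, ← EReal.coe_neg, EReal.toENNReal_of_ne_top (EReal.coe_ne_top _),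
      EReal.toReal_coe]
  have f1 := hint.lintegral_lt_top.ne
  have f2 := hint.neg.lintegral_lt_top.ne
  rw [energy, h1, h2, integral_eq_lintegral_pos_part_sub_lintegral_neg_part hint, EReal.coe_sub]
  simp only [Pi.neg_apply] at f2
  rw [EReal.coe_ennreal_toReal f1, EReal.coe_ennreal_toReal f2]

lemma ae_prod_ne {ν : Measure ℝ} [SFinite ν] [NullSingletonClass ν] :
    ∀ᵐ p : ℝ × ℝ ∂(ν.prod ν), p.1 ≠ p.2 := by
  have : (ν.prod ν) (Set.diagonal ℝ) = 0 := by
    rw [Measure.measure_prod_null measurableSet_diagonal]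
    filter_upwards with s
    have : Prod.mk s ⁻¹' Set.diagonal ℝ = {s} := by
      ext t; simp [eq_comm]
    simp [this]
  rw [ae_iff]
  convert this using 2
  ext p; simp

/-- Supplies a competitor of finite energy, the uniform measure on `[0, 1]`; it works because `log`
is locally integrable. -/
lemma integrable_realKernel_unitInterval {V : ℝ → ℝ} (hV : Continuous V) :
    Integrable (fun p : ℝ × ℝ => realKernel V p.1 p.2)
      ((volume.restrict (Set.Icc (0 : ℝ) 1)).prod (volume.restrict (Set.Icc (0 : ℝ) 1))) := by
  have hVi : Integrable V (volume.restrict (Set.Icc (0 : ℝ) 1)) :=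
    hV.continuousOn.integrableOn_Icc
  have hlog : IntegrableOn Real.log (Set.Icc (-1 : ℝ) 1) := by
    rw [← intervalIntegrable_iff_integrableOn_Icc_of_le (by norm_num)]
    exact intervalIntegral.intervalIntegrable_log'
  refine Integrable.add (f := fun p : ℝ × ℝ => -Real.log (p.1 - p.2)) ?_
    (((hVi.comp_fst _).add (hVi.comp_snd _)).div_const 2)
  have hm : Measurable fun p : ℝ × ℝ => Real.log (p.1 - p.2) := by fun_prop
  refine Integrable.neg ⟨hm.aestronglyMeasurable, ?_⟩
  rw [HasFiniteIntegral, lintegral_prod _ hm.enorm.aemeasurable]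
  calc ∫⁻ s in Set.Icc (0 : ℝ) 1, ∫⁻ t in Set.Icc (0 : ℝ) 1, ‖Real.log (s - t)‖ₑ
      ≤ ∫⁻ s in Set.Icc (0 : ℝ) 1, ∫⁻ u in Set.Icc (-1 : ℝ) 1, ‖Real.log u‖ₑ := by
        refine setLIntegral_mono measurable_const fun s hs => ?_
        rw [← lintegral_indicator measurableSet_Icc, ← lintegral_indicator measurableSet_Icc,
          ← lintegral_sub_left_eq_self ((Set.Icc (-1 : ℝ) 1).indicator fun u => ‖Real.log u‖ₑ) s]
        refine lintegral_mono fun t => ?_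
        by_cases ht : t ∈ Set.Icc (0 : ℝ) 1
        · have : s - t ∈ Set.Icc (-1 : ℝ) 1 := by
            simp only [Set.mem_Icc] at *
            constructor <;> linarith
          simp [Set.indicator_of_mem ht, Set.indicator_of_mem this]
        · simp [Set.indicator_of_notMem ht]
    _ < ⊤ := by
        rw [setLIntegral_const]
        exact ENNReal.mul_lt_top hlog.2 (by simp)

/-- Minimality against the uniform measure makes the energy less than `⊤`. The kernel is bounded
below, so its positive part has finite integral too; as the kernel is `⊤` on the diagonal, the
diagonal is null. -/
theorem IsEquilibriumMeasure.integrable_realKernel {V : ℝ → ℝ} (hV : IsAdmissible V)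
    {μ : Measure ℝ} (hμ : IsEquilibriumMeasure V μ) :
    Integrable (fun p : ℝ × ℝ => realKernel V p.1 p.2) (μ.prod μ) ∧
      ∀ᵐ p : ℝ × ℝ ∂(μ.prod μ), p.1 ≠ p.2 := by
  have := hμ.isProbability
  have hprob : IsProbabilityMeasure (volume.restrict (Set.Icc (0 : ℝ) 1)) := ⟨by simp⟩
  obtain ⟨C, hC⟩ := hV.exists_le_realKernel
  have hfin : energy V μ < ⊤ := by
    refine (hμ.minimizes _ hprob).trans_lt ?_
    rw [energy_eq_integral (integrable_realKernel_unitInterval hV.continuous) ae_prod_ne]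
    exact EReal.coe_lt_top _
  have hneg : ∫⁻ p : ℝ × ℝ, (-kernel V p.1 p.2).toENNReal ∂(μ.prod μ) ≤ ENNReal.ofReal C := by
    calc _ ≤ ∫⁻ p : ℝ × ℝ, ENNReal.ofReal C ∂(μ.prod μ) := by
          refine lintegral_mono fun p => ?_
          rcases eq_or_ne p.1 p.2 with h | h
          · simp [h, kernel_self]
          · simp only
            rw [kernel_eq_realKernel V h, ← EReal.coe_neg,
              EReal.toENNReal_of_ne_top (EReal.coe_ne_top _), EReal.toReal_coe]
            exact ENNReal.ofReal_le_ofReal (by linarith [hC p.1 p.2])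
      _ = _ := by simp
  have hpos : ∫⁻ p : ℝ × ℝ, (kernel V p.1 p.2).toENNReal ∂(μ.prod μ) ≠ ⊤ := by
    intro htop
    rw [energy, htop] at hfin
    have hne := (hneg.trans_lt ENNReal.ofReal_lt_top).ne
    rw [EReal.coe_ennreal_top, EReal.top_sub (by simpa using hne)] at hfin
    exact lt_irrefl _ hfin
  have hdiag : (μ.prod μ) (Set.diagonal ℝ) = 0 := by
    by_contra h0
    refine hpos (top_unique ?_)
    calc (⊤ : ENNReal) = ∫⁻ p, (Set.diagonal ℝ).indicator (fun _ => ⊤) p ∂(μ.prod μ) := by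
          rw [lintegral_indicator_const measurableSet_diagonal, ENNReal.top_mul h0]
      _ ≤ _ := by
          refine lintegral_mono fun p => ?_
          by_cases hp : p ∈ Set.diagonal ℝ
          · have hp' : p.1 = p.2 := hp
            simp [hp', kernel_self]
          · simp [Set.indicator_of_notMem hp]
  have hae : ∀ᵐ p : ℝ × ℝ ∂(μ.prod μ), p.1 ≠ p.2 := by
    rw [ae_iff]
    convert hdiag using 2
    ext p; simp
  refine ⟨⟨(measurable_realKernel hV.continuous).aestronglyMeasurable, ?_⟩, hae⟩
  calc ∫⁻ p : ℝ × ℝ, ‖realKernel V p.1 p.2‖ₑ ∂(μ.prod μ)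
      ≤ ∫⁻ p : ℝ × ℝ, ((kernel V p.1 p.2).toENNReal + ENNReal.ofReal (2 * |C|)) ∂(μ.prod μ) := by
        refine lintegral_mono_ae (hae.mono fun p hp => ?_)
        rw [kernel_eq_realKernel V hp, EReal.toENNReal_of_ne_top (EReal.coe_ne_top _),
          EReal.toReal_coe, Real.enorm_eq_ofReal_abs]
        refine le_trans (ENNReal.ofReal_le_ofReal ?_) ENNReal.ofReal_add_le
        have := hC p.1 p.2
        rcases abs_cases (realKernel V p.1 p.2) with h | h <;>
          linarith [le_abs_self C, abs_nonneg C]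
    _ < ⊤ := by
        rw [lintegral_add_right _ measurable_const]
        simp [hpos.lt_top, ENNReal.mul_lt_top]

/-! ### First variation and the Euler–Lagrange equation -/

lemma nonneg_of_forall_quadratic {A B : ℝ} (h : ∀ ε, 0 < ε → ε ≤ 1 → 0 ≤ 2 * (ε * A) + ε ^ 2 * B) :
    0 ≤ A := by
  by_contra! hA
  have hd : 0 < |B| - A + 1 := by linarith [abs_nonneg B]
  -- Chosen so that `ε|B| < -A`, whence `2A + εB < A < 0`, and so that `ε ≤ 1`.
  set ε := -A / (|B| - A + 1) with hε
  have h0 : 0 < ε := div_pos (by linarith) hd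
  have h1 : ε ≤ 1 := (div_le_one hd).2 (by linarith [abs_nonneg B])
  have h2 := h ε h0 h1
  have h3 : 0 ≤ 2 * A + ε * B := by
    have : 0 ≤ ε * (2 * A + ε * B) := by linarith
    exact nonneg_of_mul_nonneg_right this h0
  have h4 : ε * (|B| - A + 1) = -A := div_mul_cancel₀ _ hd.ne'
  nlinarith [le_abs_self B, abs_nonneg B]

/-- For `0 < ε ≤ 1` the measure `(1 + εf) μ` is again a probability measure, and its energy is a
quadratic polynomial in `ε`. By symmetry of the kernel the linear coefficient is twice the integral
in question. -/
theorem IsEquilibriumMeasure.variation_nonneg {V : ℝ → ℝ} (hV : IsAdmissible V)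
    {μ : Measure ℝ} (hμ : IsEquilibriumMeasure V μ) {f : ℝ → ℝ} (hf : Measurable f)
    (hf1 : ∀ s, |f s| ≤ 1) (hf0 : ∫ s, f s ∂μ = 0) :
    0 ≤ ∫ p : ℝ × ℝ, f p.1 * realKernel V p.1 p.2 ∂(μ.prod μ) := by
  have := hμ.isProbability
  obtain ⟨hK, hne⟩ := hμ.integrable_realKernel hV
  have hfi : Integrable f μ := Integrable.of_bound hf.aestronglyMeasurable 1
    (Eventually.of_forall hf1)
  have hK1 : Integrable (fun p : ℝ × ℝ => f p.1 * realKernel V p.1 p.2) (μ.prod μ) :=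
    hK.bdd_mul (c := 1) (hf.comp measurable_fst).aestronglyMeasurable
      (Eventually.of_forall fun p => hf1 p.1)
  have hK2 : Integrable (fun p : ℝ × ℝ => f p.2 * realKernel V p.1 p.2) (μ.prod μ) :=
    hK.bdd_mul (c := 1) (hf.comp measurable_snd).aestronglyMeasurable
      (Eventually.of_forall fun p => hf1 p.2)
  have hK12 : Integrable (fun p : ℝ × ℝ => f p.1 * (f p.2 * realKernel V p.1 p.2)) (μ.prod μ) :=
    hK2.bdd_mul (c := 1) (hf.comp measurable_fst).aestronglyMeasurable
      (Eventually.of_forall fun p => hf1 p.1)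
  have hsymm : ∫ p : ℝ × ℝ, f p.2 * realKernel V p.1 p.2 ∂(μ.prod μ) =
      ∫ p : ℝ × ℝ, f p.1 * realKernel V p.1 p.2 ∂(μ.prod μ) := by
    rw [← integral_prod_swap]
    simp only [Prod.fst_swap, Prod.snd_swap, realKernel_comm V]
  refine nonneg_of_forall_quadratic
    (B := ∫ p : ℝ × ℝ, f p.1 * (f p.2 * realKernel V p.1 p.2) ∂(μ.prod μ)) fun ε h0 h1 => ?_
  have hw : ∀ s, 0 ≤ 1 + ε * f s := fun s => by
    nlinarith [(abs_le.1 (hf1 s)).1]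
  have hwm : Measurable fun s => ENNReal.ofReal (1 + ε * f s) := by fun_prop
  set ν := μ.withDensity fun s => ENNReal.ofReal (1 + ε * f s) with hν
  have hνp : IsProbabilityMeasure ν := by
    refine ⟨?_⟩
    rw [hν, withDensity_apply _ MeasurableSet.univ, Measure.restrict_univ,
      ← ofReal_integral_eq_lintegral_ofReal (f := fun s => 1 + ε * f s)
        ((integrable_const _).add (hfi.const_mul ε)) (Eventually.of_forall hw), integral_add (integrable_const _) (hfi.const_mul ε),
      integral_const_mul, hf0]
    simp
  have hprod : ν.prod ν = (μ.prod μ).withDensity fun p =>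
      ENNReal.ofReal (1 + ε * f p.1) * ENNReal.ofReal (1 + ε * f p.2) :=
    prod_withDensity hwm hwm
  have hm2 : Measurable fun p : ℝ × ℝ =>
      ENNReal.ofReal (1 + ε * f p.1) * ENNReal.ofReal (1 + ε * f p.2) := by fun_prop
  have hlt : ∀ᵐ p : ℝ × ℝ ∂(μ.prod μ),
      ENNReal.ofReal (1 + ε * f p.1) * ENNReal.ofReal (1 + ε * f p.2) < ⊤ :=
    Eventually.of_forall fun p => ENNReal.mul_lt_top ENNReal.ofReal_lt_top ENNReal.ofReal_lt_top
  have hexp : (fun p : ℝ × ℝ => (ENNReal.ofReal (1 + ε * f p.1) *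
      ENNReal.ofReal (1 + ε * f p.2)).toReal • realKernel V p.1 p.2) =
      fun p => realKernel V p.1 p.2 + (ε * (f p.1 * realKernel V p.1 p.2) +
        (ε * (f p.2 * realKernel V p.1 p.2) +
          ε ^ 2 * (f p.1 * (f p.2 * realKernel V p.1 p.2)))) := by
    ext p
    rw [ENNReal.toReal_mul, ENNReal.toReal_ofReal (hw _), ENNReal.toReal_ofReal (hw _), smul_eq_mul]
    ring
  have i2 : Integrable (fun p : ℝ × ℝ => ε * (f p.2 * realKernel V p.1 p.2) +
      ε ^ 2 * (f p.1 * (f p.2 * realKernel V p.1 p.2))) (μ.prod μ) := (hK2.const_mul ε).add (hK12.const_mul (ε ^ 2))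
  have i1 : Integrable (fun p : ℝ × ℝ => ε * (f p.1 * realKernel V p.1 p.2) +
      (ε * (f p.2 * realKernel V p.1 p.2) +
        ε ^ 2 * (f p.1 * (f p.2 * realKernel V p.1 p.2)))) (μ.prod μ) := (hK1.const_mul ε).add i2
  have hνK : Integrable (fun p : ℝ × ℝ => realKernel V p.1 p.2) (ν.prod ν) := by
    rw [hprod, integrable_withDensity_iff_integrable_smul' hm2 hlt, hexp]
    exact hK.add i1
  have hνne : ∀ᵐ p : ℝ × ℝ ∂(ν.prod ν), p.1 ≠ p.2 := by
    rw [hprod]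
    exact (withDensity_absolutelyContinuous _ _).ae_le hne
  have key := hμ.minimizes ν hνp
  rw [energy_eq_integral hK hne, energy_eq_integral hνK hνne, EReal.coe_le_coe_iff, hprod,
    integral_withDensity_eq_integral_toReal_smul hm2 hlt, hexp, integral_add hK i1,
    integral_add (hK1.const_mul ε) i2, integral_add (hK2.const_mul ε) (hK12.const_mul (ε ^ 2)),
    integral_const_mul, integral_const_mul, integral_const_mul, hsymm] at key
  linarith

/-- The Euler–Lagrange equation of the equilibrium problem. -/
theorem IsEquilibriumMeasure.eulerLagrange {V : ℝ → ℝ} (hV : IsAdmissible V)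
    {μ : Measure ℝ} (hμ : IsEquilibriumMeasure V μ) :
    ∃ c, ∀ᵐ s ∂μ, Integrable (fun t => realKernel V s t) μ ∧ ∫ t, realKernel V s t ∂μ = c := by
  have := hμ.isProbability
  obtain ⟨hK, -⟩ := hμ.integrable_realKernel hV
  set F : ℝ → ℝ := fun s => ∫ t, realKernel V s t ∂μ with hF
  have hFi : Integrable F μ := hK.integral_prod_left
  -- Both `f` and `-f` are admissible variations, so the inequality becomes an equality.
  have hzero : ∀ f : ℝ → ℝ, Measurable f → (∀ s, |f s| ≤ 1) → ∫ s, f s ∂μ = 0 →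
      ∫ s, f s * F s ∂μ = 0 := by
    intro f hf hf1 hf0
    have hfK : ∀ g : ℝ → ℝ, Measurable g → (∀ s, |g s| ≤ 1) →
        ∫ p : ℝ × ℝ, g p.1 * realKernel V p.1 p.2 ∂(μ.prod μ) = ∫ s, g s * F s ∂μ := by
      intro g hg hg1
      rw [integral_prod (fun p : ℝ × ℝ => g p.1 * realKernel V p.1 p.2) (hK.bdd_mul (c := 1) (hg.comp measurable_fst).aestronglyMeasurable
        (Eventually.of_forall fun p => hg1 p.1))]
      simp only [integral_const_mul, hF]
    have h1 := hμ.variation_nonneg hV hf hf1 hf0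
    have h2 := hμ.variation_nonneg hV hf.neg (by simpa using hf1)
      (by simpa [integral_neg] using hf0)
    rw [hfK f hf hf1] at h1
    rw [hfK _ hf.neg (by simpa using hf1)] at h2
    simp only [Pi.neg_apply, neg_mul, integral_neg] at h2
    linarith
  refine ⟨∫ s, F s ∂μ, hK.prod_right_ae.and ?_⟩
  refine Integrable.ae_eq_of_forall_setIntegral_eq F (fun _ => ∫ s, F s ∂μ) hFi
    (integrable_const _) fun A hA _ => ?_
  have hi : Integrable (A.indicator fun _ => (1 : ℝ)) μ := (integrable_const _).indicator hA
  -- The centred indicator of `A` gives `∫_A F = μ(A) ∫ F` for every measurable `A`, which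
  -- identifies `F` with its mean.
  have h := hzero (fun s => A.indicator (fun _ => (1 : ℝ)) s - μ.real A)
    ((measurable_const.indicator hA).sub_const _) (fun s => ?_) ?_
  · simp only [sub_mul] at h
    have e : (fun s => A.indicator (fun _ => (1 : ℝ)) s * F s) = A.indicator F := by
      ext s
      by_cases hs : s ∈ A <;> simp [hs]
    rw [integral_sub (by rw [e]; exact hFi.indicator hA) (hFi.const_mul _), e,
      integral_indicator hA, integral_const_mul] at h
    rw [setIntegral_const, smul_eq_mul]
    linarith
  · have h0 : 0 ≤ μ.real A := measureReal_nonneg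
    have h1 : μ.real A ≤ 1 := measureReal_le_one
    by_cases hs : s ∈ A <;> simp only [hs, Set.indicator_of_mem, Set.indicator_of_notMem,
      not_false_eq_true, abs_le] <;> constructor <;> linarith
  · rw [integral_sub hi (integrable_const _), integral_indicator hA]
    simp

/-! ### Bounds for the logarithmic Taylor remainder -/

/-- The remainder of the Taylor expansion of `log |1 - z|` at `0`. -/
noncomputable def logRemainder (n : ℕ) (z : ℝ) : ℝ :=
  Real.log (1 - z) + ∑ i ∈ Finset.range n, z ^ (i + 1) / ((i : ℝ) + 1)

lemma measurable_logRemainder (n : ℕ) : Measurable (logRemainder n) := by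
  unfold logRemainder
  fun_prop

lemma abs_logRemainder_le_of_abs_le_half (n : ℕ) {z : ℝ} (hz : |z| ≤ 1 / 2) :
    |logRemainder n z| ≤ 2 * |z| ^ (n + 1) := by
  have h := Real.abs_log_sub_add_sum_range_le (x := z) (by linarith) n
  rw [logRemainder, add_comm]
  refine h.trans ?_
  rw [div_le_iff₀ (by linarith)]
  have : 0 ≤ |z| ^ (n + 1) := by positivity
  nlinarith

lemma abs_log_le_two_mul_inv_sqrt {w : ℝ} (h0 : 0 ≤ w) (h1 : w ≤ 1) :
    |Real.log w| ≤ 2 * (√w)⁻¹ := by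
  rcases h0.eq_or_lt with rfl | h0
  · simp
  have h := Real.abs_log_mul_self_rpow_lt w (1 / 2) h0 h1 (by norm_num)
  rw [← Real.sqrt_eq_rpow, abs_mul, abs_of_nonneg (Real.sqrt_nonneg w)] at h
  rw [← div_eq_mul_inv, le_div_iff₀ (Real.sqrt_pos.2 h0)]
  linarith

/-- Valid for all `z`: the order is `|z|^n`, not `|z|^(n+1)`, because the polynomial part dominates
at infinity. The singularity at `z = 1` is isolated in a separate term, with the logarithm traded
for an integrable inverse square root. -/
lemma abs_logRemainder_le {n : ℕ} (hn : 1 ≤ n) (z : ℝ) :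
    |logRemainder n z| ≤ (n + 2) * 2 ^ n * |z| ^ n +
      {w : ℝ | |1 - w| < 1 / 2}.indicator (fun w => 2 * (√|1 - w|)⁻¹) z := by
  have hind : 0 ≤ {w : ℝ | |1 - w| < 1 / 2}.indicator (fun w => 2 * (√|1 - w|)⁻¹) z :=
    Set.indicator_nonneg (fun w _ => by positivity) z
  rcases le_or_gt |z| (1 / 2) with hz | hz
  · have h := abs_logRemainder_le_of_abs_le_half n hz
    have h1 : 2 * |z| ^ (n + 1) ≤ 1 * |z| ^ n := by
      rw [pow_succ]
      nlinarith [pow_nonneg (abs_nonneg z) n]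
    have h2 : 1 * |z| ^ n ≤ (n + 2) * 2 ^ n * |z| ^ n := by
      gcongr
      have : (1 : ℝ) ≤ 2 ^ n := one_le_pow₀ (by norm_num)
      nlinarith [(Nat.cast_nonneg n : (0 : ℝ) ≤ n)]
    linarith
  -- Here `2|z| > 1`, so powers of `2|z|` increase with the exponent; this is the source of `2 ^ n`.
  have hpow : ∀ i, i < n → |z| ^ (i + 1) ≤ 2 ^ n * |z| ^ n := fun i hi => by
    rw [← mul_pow]
    calc |z| ^ (i + 1) ≤ (2 * |z|) ^ (i + 1) := by gcongr; linarith
      _ ≤ (2 * |z|) ^ n := pow_le_pow_right₀ (by linarith) hi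
  have hone : 1 ≤ 2 ^ n * |z| ^ n := by
    rw [← mul_pow]
    exact one_le_pow₀ (by linarith)
  have hsum : |∑ i ∈ Finset.range n, z ^ (i + 1) / ((i : ℝ) + 1)| ≤ n * (2 ^ n * |z| ^ n) := by
    refine (Finset.abs_sum_le_sum_abs _ _).trans ?_
    refine (Finset.sum_le_card_nsmul _ _ (2 ^ n * |z| ^ n) fun i hi => ?_).trans (by simp)
    rw [abs_div, abs_pow]
    have hi1 : (1 : ℝ) ≤ |(i : ℝ) + 1| := by
      rw [abs_of_nonneg (by positivity)]
      linarith [(Nat.cast_nonneg i : (0 : ℝ) ≤ i)]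
    exact (div_le_self (by positivity) hi1).trans (hpow i (Finset.mem_range.1 hi))
  have hR : |logRemainder n z| ≤ |(Real.log |1 - z|)| + n * (2 ^ n * |z| ^ n) := by
    rw [logRemainder, Real.log_abs]
    exact (abs_add_le _ _).trans (by linarith)
  by_cases hw : |1 - z| < 1 / 2
  · rw [Set.indicator_of_mem (by exact hw)]
    have := abs_log_le_two_mul_inv_sqrt (abs_nonneg (1 - z)) (by linarith)
    nlinarith
  · push Not at hw
    have hz1 := hpow 0 hn
    rw [zero_add, pow_one] at hz1
    have hlog : |(Real.log |1 - z|)| ≤ 2 ^ n * |z| ^ n + 2 ^ n * |z| ^ n := by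
      have h1 := Real.log_le_sub_one_of_pos (x := |1 - z|) (by linarith)
      have h2 := Real.one_sub_inv_le_log_of_pos (x := |1 - z|) (by linarith)
      have h3 : |1 - z|⁻¹ ≤ 2 := by
        rw [inv_le_comm₀ (by linarith) (by norm_num)]
        linarith
      have h4 : |1 - z| ≤ 1 + |z| := (abs_sub _ _).trans (by simp)
      rw [abs_le]
      constructor <;> linarith
    nlinarith

lemma lintegral_inv_sqrt_abs_lt_top :
    ∫⁻ u in Set.Icc (-1 : ℝ) 1, ENNReal.ofReal (√|u|)⁻¹ < ⊤ := by
  have h1 : IntervalIntegrable (fun u : ℝ => (√|u|)⁻¹) volume 0 1 := by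
    refine (intervalIntegral.intervalIntegrable_rpow' (a := 0) (b := 1) (r := -(1 / 2))
      (by norm_num)).congr fun u hu => ?_
    rw [Set.uIoc_of_le zero_le_one] at hu
    rw [Real.rpow_neg hu.1.le, abs_of_pos hu.1, Real.sqrt_eq_rpow]
  have h2 : IntervalIntegrable (fun u : ℝ => (√|u|)⁻¹) volume (-1) 0 := by
    have := (IntervalIntegrable.iff_comp_neg (f := fun u : ℝ => (√|u|)⁻¹)).1 h1
    simpa using this.symm
  have h3 := h2.trans h1
  rw [intervalIntegrable_iff_integrableOn_Icc_of_le (by norm_num)] at h3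
  exact h3.lintegral_lt_top

/-! ### Moments and remainder integrals under a density bound -/

/-- The density of `μ` is at most `C |s - x|^n` on the interval of radius `r` about `x`. -/
def DensityBound (μ : Measure ℝ) (x : ℝ) (n : ℕ) (r C : ℝ) : Prop :=
  μ.restrict (Set.Ioo (x - r) (x + r)) ≤
    (volume.restrict (Set.Ioo (x - r) (x + r))).withDensity
      fun s => ENNReal.ofReal (C * |s - x| ^ n)

namespace DensityBound

variable {μ : Measure ℝ} {x : ℝ} {n : ℕ} {r C : ℝ}

lemma setLIntegral_le (h : DensityBound μ x n r C) {g : ℝ → ENNReal} (hg : Measurable g) :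
    ∫⁻ s in Set.Ioo (x - r) (x + r), g s ∂μ ≤
      ∫⁻ s in Set.Ioo (x - r) (x + r), ENNReal.ofReal (C * |s - x| ^ n) * g s := by
  refine (lintegral_mono' h le_rfl).trans_eq ?_
  rw [lintegral_withDensity_eq_lintegral_mul _ (by fun_prop) hg]
  rfl

lemma measure_singleton (h : DensityBound μ x n r C) {y : ℝ}
    (hy : y ∈ Set.Ioo (x - r) (x + r)) : μ {y} = 0 := by
  have h1 : μ {y} = μ.restrict (Set.Ioo (x - r) (x + r)) {y} := by
    rw [Measure.restrict_apply (measurableSet_singleton y),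
      Set.inter_eq_left.2 (Set.singleton_subset_iff.2 hy)]
  rw [h1]
  refine le_antisymm ((h {y}).trans_eq ?_) zero_le
  exact (withDensity_absolutelyContinuous _ _) (by simp)

/-- Near `x` the density cancels the singularity; elsewhere the integrand is at most `r^(-n)` and
`μ` is finite. -/
lemma integrable_inv_pow_self [IsFiniteMeasure μ] (h : DensityBound μ x n r C) (hr : 0 < r) :
    Integrable (fun s => 1 / |s - x| ^ n) μ := by
  have hm : Measurable fun s => 1 / |s - x| ^ n := by fun_prop
  have hon : IntegrableOn (fun s => 1 / |s - x| ^ n) (Set.Ioo (x - r) (x + r)) μ := by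
    refine ⟨hm.aestronglyMeasurable, ?_⟩
    refine (h.setLIntegral_le hm.enorm).trans_lt ?_
    calc ∫⁻ s in Set.Ioo (x - r) (x + r), ENNReal.ofReal (C * |s - x| ^ n) * ‖1 / |s - x| ^ n‖ₑ
        ≤ ∫⁻ s in Set.Ioo (x - r) (x + r), ENNReal.ofReal |C| := by
          refine lintegral_mono fun s => ?_
          simp only
          rw [Real.enorm_of_nonneg (by positivity), ← ENNReal.ofReal_mul' (by positivity)]
          refine ENNReal.ofReal_le_ofReal ?_
          rcases eq_or_ne (|s - x| ^ n) 0 with h0 | h0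
          · simp [h0]
          · rw [mul_assoc, mul_one_div_cancel h0, mul_one]
            exact le_abs_self C
      _ < ⊤ := by
          rw [setLIntegral_const]
          exact ENNReal.mul_lt_top ENNReal.ofReal_lt_top (by simp)
  have hoff : IntegrableOn (fun s => 1 / |s - x| ^ n) (Set.Ioo (x - r) (x + r))ᶜ μ := by
    refine Measure.integrableOn_of_bounded (M := 1 / r ^ n) (measure_ne_top _ _)
      hm.aestronglyMeasurable ?_
    filter_upwards [ae_restrict_mem measurableSet_Ioo.compl] with s hs
    have : r ≤ |s - x| := by
      by_contra! hlt
      rw [abs_lt] at hlt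
      exact hs ⟨by linarith, by linarith⟩
    rw [Real.norm_of_nonneg (by positivity)]
    gcongr
  rw [← integrableOn_univ, ← Set.union_compl_self (Set.Ioo (x - r) (x + r))]
  exact hon.union hoff

lemma integrable_inv_pow [IsFiniteMeasure μ] (h : DensityBound μ x n r C) (hr : 0 < r)
    {j : ℕ} (hj : j ≤ n) : Integrable (fun s => 1 / (s - x) ^ j) μ := by
  have hm : Measurable fun s => 1 / (s - x) ^ j := by fun_prop
  refine ((integrable_const 1).add (h.integrable_inv_pow_self hr)).mono' hm.aestronglyMeasurable
    (Eventually.of_forall fun s => ?_)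
  simp only [Pi.add_apply, norm_div, norm_one, norm_pow, Real.norm_eq_abs]
  have h0 : 0 ≤ 1 / |s - x| ^ n := by positivity
  have h0' : 0 ≤ |s - x| := abs_nonneg _
  rcases h0'.eq_or_lt with h1 | h1
  · rw [← h1] at h0 ⊢
    rcases Nat.eq_zero_or_pos j with rfl | hj0
    · simp
    · rw [zero_pow hj0.ne', div_zero]
      linarith
  rcases le_or_gt 1 |s - x| with h2 | h2
  · have : 1 / |s - x| ^ j ≤ 1 := (div_le_one (by positivity)).2 (one_le_pow₀ h2)
    linarith
  · have : 1 / |s - x| ^ j ≤ 1 / |s - x| ^ n :=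
      one_div_le_one_div_of_le (by positivity) (pow_le_pow_of_le_one h0' h2.le hj)
    linarith

/-- The part of the remainder integral near the logarithmic singularity. -/
lemma exists_lintegral_singular_le (h : DensityBound μ x n r C) (hr : 0 < r) :
    ∃ K : ℝ, ∀ᶠ δ : ℝ in 𝓝[≠] 0,
      ∫⁻ s, ENNReal.ofReal ({w : ℝ | |1 - w| < 1 / 2}.indicator (fun w => 2 * (√|1 - w|)⁻¹)
        (δ / (s - x))) ∂μ ≤ ENNReal.ofReal (K * |δ| ^ n * √|δ|) := by
  set M := ∫⁻ u in Set.Icc (-1 : ℝ) 1, ENNReal.ofReal (√|u|)⁻¹ with hM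
  have hMtop : M < ⊤ := lintegral_inv_sqrt_abs_lt_top
  refine ⟨|C| * 2 ^ n * (2 * √2) * M.toReal, ?_⟩
  -- The singular region lies in `|s - x| < 2|δ|`: the bound `r/2` keeps it where the density bound
  -- holds, and `1/3` gives `|s - (x + δ)| ≤ 3|δ| ≤ 1`.
  have hsmall : ∀ᶠ δ : ℝ in 𝓝[≠] 0, |δ| < min (r / 2) (1 / 3) := by
    refine nhdsWithin_le_nhds ?_
    have : 0 < min (r / 2) (1 / 3) := by positivity
    filter_upwards [Metric.ball_mem_nhds (0 : ℝ) this] with δ hδ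
    simpa using hδ
  filter_upwards [hsmall, self_mem_nhdsWithin] with δ hδ hδ0
  have hδpos : 0 < |δ| := abs_pos.2 hδ0
  obtain ⟨hδr, hδ3⟩ := lt_min_iff.1 hδ
  set g : ℝ → ℝ := fun s => {w : ℝ | |1 - w| < 1 / 2}.indicator (fun w => 2 * (√|1 - w|)⁻¹)
    (δ / (s - x)) with hg
  have hgm : Measurable g := by
    have h1 : Measurable ({w : ℝ | |1 - w| < 1 / 2}.indicator fun w => 2 * (√|1 - w|)⁻¹) :=
      Measurable.indicator (by fun_prop) (measurableSet_lt (by fun_prop) (by fun_prop))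
    exact h1.comp (by fun_prop)
  -- On the support of `g`, the point `s` lies between `x` and `x + 2 δ`.
  have hloc : ∀ s, |1 - δ / (s - x)| < 1 / 2 →
      0 < |s - x| ∧ |s - x| < 2 * |δ| ∧ |1 - δ / (s - x)| = |s - (x + δ)| / |s - x| := by
    intro s hs
    have hsx : s - x ≠ 0 := by
      intro h0
      rw [h0, div_zero, sub_zero, abs_one] at hs
      norm_num at hs
    have hpos : 0 < |s - x| := abs_pos.2 hsx
    have h1 : 1 / 2 < |δ| / |s - x| := by
      rw [← abs_div]
      linarith [(abs_lt.1 hs).2, le_abs_self (δ / (s - x))]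
    rw [lt_div_iff₀ hpos] at h1
    refine ⟨hpos, by linarith, ?_⟩
    rw [← abs_div]
    congr 1
    field_simp
    ring
  have hsupp : ∀ s, s ∉ Set.Ioo (x - r) (x + r) → g s = 0 := by
    intro s hs
    refine Set.indicator_of_notMem (fun hmem => hs ?_) _
    obtain ⟨-, h2, -⟩ := hloc s hmem
    have := abs_lt.1 (h2.trans (by linarith : 2 * |δ| < r))
    exact ⟨by linarith, by linarith⟩
  have hrestr : ∫⁻ s, ENNReal.ofReal (g s) ∂μ =
      ∫⁻ s in Set.Ioo (x - r) (x + r), ENNReal.ofReal (g s) ∂μ := by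
    rw [← lintegral_indicator measurableSet_Ioo]
    congr 1
    ext s
    by_cases hs : s ∈ Set.Ioo (x - r) (x + r)
    · rw [Set.indicator_of_mem hs]
    · rw [Set.indicator_of_notMem hs, hsupp s hs, ENNReal.ofReal_zero]
  rw [hrestr]
  refine (h.setLIntegral_le hgm.ennreal_ofReal).trans ?_
  -- From `|s - x| < 2|δ|` in both the density bound and the numerator of `√|s - x| / √|s - (x +
  -- δ)|`; the total is of order `|δ|^(n + 1/2)`.
  set A := |C| * (2 * |δ|) ^ n * (2 * √(2 * |δ|)) with hA
  have hA0 : 0 ≤ A := by positivity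
  calc ∫⁻ s in Set.Ioo (x - r) (x + r), ENNReal.ofReal (C * |s - x| ^ n) * ENNReal.ofReal (g s)
      ≤ ∫⁻ s in Set.Ioo (x - r) (x + r), ENNReal.ofReal A *
          (Set.Icc (-1 : ℝ) 1).indicator (fun u => ENNReal.ofReal (√|u|)⁻¹) (s - (x + δ)) := by
        refine lintegral_mono fun s => ?_
        by_cases hs : |1 - δ / (s - x)| < 1 / 2
        · obtain ⟨h1, h2, h3⟩ := hloc s hs
          have hmem : s - (x + δ) ∈ Set.Icc (-1 : ℝ) 1 := by
            have : |s - (x + δ)| ≤ |s - x| + |δ| := by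
              rw [← sub_sub]
              exact abs_sub _ _
            exact abs_le.1 (by linarith)
          rw [Set.indicator_of_mem hmem, ← ENNReal.ofReal_mul hA0,
            ← ENNReal.ofReal_mul' (Set.indicator_nonneg (fun w _ => by positivity) _)]
          refine ENNReal.ofReal_le_ofReal ?_
          have hgs : g s = 2 * (√|1 - δ / (s - x)|)⁻¹ := Set.indicator_of_mem (by exact hs) _
          change C * |s - x| ^ n * g s ≤ _
          rw [hgs, h3, Real.sqrt_div (abs_nonneg _), inv_div, hA]
          calc C * |s - x| ^ n * (2 * (√|s - x| / √|s - (x + δ)|))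
              ≤ |C| * (2 * |δ|) ^ n * (2 * (√(2 * |δ|) / √|s - (x + δ)|)) := by
                gcongr
                exact le_abs_self C
            _ = _ := by ring
        · have : g s = 0 := Set.indicator_of_notMem (by exact hs) _
          simp [this]
    _ ≤ ∫⁻ s, ENNReal.ofReal A *
          (Set.Icc (-1 : ℝ) 1).indicator (fun u => ENNReal.ofReal (√|u|)⁻¹) (s - (x + δ)) :=
        setLIntegral_le_lintegral _ _
    _ = ENNReal.ofReal A * M := by
        rw [lintegral_const_mul' _ _ ENNReal.ofReal_ne_top,
          lintegral_sub_right_eq_self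
            ((Set.Icc (-1 : ℝ) 1).indicator fun u => ENNReal.ofReal (√|u|)⁻¹),
          lintegral_indicator measurableSet_Icc]
    _ = ENNReal.ofReal (|C| * 2 ^ n * (2 * √2) * M.toReal * |δ| ^ n * √|δ|) := by
        conv_lhs => rw [← ENNReal.ofReal_toReal hMtop.ne]
        rw [← ENNReal.ofReal_mul hA0, hA, Real.sqrt_mul (by norm_num), mul_pow]
        congr 1
        ring

/-- The remainder is split into a regular part, treated by dominated convergence after division by
`|δ|^n`, and the part near `s = x + δ`, which is `O(|δ|^(n + 1/2))`. -/
lemma eventually_integrable_and_tendsto [IsFiniteMeasure μ] (h : DensityBound μ x n r C)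
    (hr : 0 < r) (hn : 1 ≤ n) :
    (∀ᶠ δ : ℝ in 𝓝[≠] 0, Integrable (fun s => logRemainder n (δ / (s - x))) μ) ∧
      (fun δ : ℝ => ∫ s, logRemainder n (δ / (s - x)) ∂μ) =o[𝓝[≠] 0] fun δ => δ ^ n := by
  obtain ⟨K, hK⟩ := h.exists_lintegral_singular_le hr
  set B : ℝ := (n + 2) * 2 ^ n with hB
  have hB0 : 0 ≤ B := by positivity
  set g : ℝ → ℝ → ℝ := fun δ s => {w : ℝ | |1 - w| < 1 / 2}.indicator
    (fun w => 2 * (√|1 - w|)⁻¹) (δ / (s - x)) with hg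
  have hg0 : ∀ δ s, 0 ≤ g δ s := fun δ s => Set.indicator_nonneg (fun w _ => by positivity) _
  have hgm : ∀ δ, Measurable (g δ) := fun δ => by
    have h1 : Measurable ({w : ℝ | |1 - w| < 1 / 2}.indicator fun w => 2 * (√|1 - w|)⁻¹) :=
      Measurable.indicator (by fun_prop) (measurableSet_lt (by fun_prop) (by fun_prop))
    exact h1.comp (by fun_prop)
  have hRm : ∀ δ, Measurable fun s => logRemainder n (δ / (s - x)) := fun δ =>
    (measurable_logRemainder n).comp (by fun_prop)
  -- The minimum keeps two bounds at once: the majorant `B|δ|^n / |s - x|^n`, and for fixed `s ≠ x`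
  -- the decay `O(|δ|^(n+1))`, which gives the pointwise limit 0.
  set a : ℝ → ℝ → ℝ := fun δ s =>
    min |logRemainder n (δ / (s - x))| (B * |δ / (s - x)| ^ n) with ha
  have ha0 : ∀ δ s, 0 ≤ a δ s := fun δ s => le_min (abs_nonneg _) (by positivity)
  have ham : ∀ δ, Measurable (a δ) := fun δ => by
    have := hRm δ
    exact (continuous_abs.measurable.comp this).min (by fun_prop)
  have hRle : ∀ δ s, |logRemainder n (δ / (s - x))| ≤ a δ s + g δ s := by
    intro δ s
    have h1 := abs_logRemainder_le hn (δ / (s - x))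
    rcases min_choice |logRemainder n (δ / (s - x))| (B * |δ / (s - x)| ^ n) with h2 | h2
    · simp only [ha, h2]
      linarith [hg0 δ s]
    · simp only [ha, h2]
      exact h1
  have hdom := (h.integrable_inv_pow_self hr).const_mul B
  have hale : ∀ δ s, a δ s ≤ |δ| ^ n * (B * (1 / |s - x| ^ n)) := fun δ s => by
    refine (min_le_right _ _).trans_eq ?_
    rw [abs_div, div_pow]
    ring
  have hai : ∀ δ, Integrable (a δ) μ := fun δ =>
    (hdom.const_mul (|δ| ^ n)).mono' (ham δ).aestronglyMeasurable
      (Eventually.of_forall fun s => by rw [Real.norm_of_nonneg (ha0 δ s)]; exact hale δ s)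
  have hgi : ∀ᶠ δ in 𝓝[≠] 0, Integrable (g δ) μ ∧ ∫ s, g δ s ∂μ ≤ |K| * |δ| ^ n * √|δ| := by
    filter_upwards [hK] with δ hδ
    have h1 : Integrable (g δ) μ := by
      refine ⟨(hgm δ).aestronglyMeasurable, ?_⟩
      rw [hasFiniteIntegral_iff_ofReal (Eventually.of_forall (hg0 δ))]
      exact hδ.trans_lt ENNReal.ofReal_lt_top
    refine ⟨h1, ?_⟩
    rw [← ofReal_integral_eq_lintegral_ofReal h1 (Eventually.of_forall (hg0 δ))] at hδ
    have h2 : K * |δ| ^ n * √|δ| ≤ |K| * |δ| ^ n * √|δ| := by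
      gcongr
      exact le_abs_self K
    exact (ENNReal.ofReal_le_ofReal_iff (by positivity)).1
      (hδ.trans (ENNReal.ofReal_le_ofReal h2))
  have hRi : ∀ᶠ δ : ℝ in 𝓝[≠] 0, Integrable (fun s => logRemainder n (δ / (s - x))) μ := by
    filter_upwards [hgi] with δ hδ
    exact ((hai δ).add hδ.1).mono' (hRm δ).aestronglyMeasurable
      (Eventually.of_forall fun s => hRle δ s)
  refine ⟨hRi, ?_⟩
  have hlim : Tendsto (fun δ : ℝ => ∫ s, a δ s / |δ| ^ n ∂μ) (𝓝[≠] 0) (𝓝 0) := by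
    suffices Tendsto (fun δ : ℝ => ∫ s, a δ s / |δ| ^ n ∂μ) (𝓝[≠] 0) (𝓝 (∫ _, (0 : ℝ) ∂μ)) by
      simpa using this
    refine tendsto_integral_filter_of_dominated_convergence (fun s => B * (1 / |s - x| ^ n))
      (Eventually.of_forall fun δ => ((ham δ).div_const _).aestronglyMeasurable) ?_ hdom ?_
    · filter_upwards [self_mem_nhdsWithin] with δ hδ0
      have hδpos : 0 < |δ| := abs_pos.2 hδ0
      refine Eventually.of_forall fun s => ?_
      rw [Real.norm_of_nonneg (div_nonneg (ha0 δ s) (by positivity)), div_le_iff₀ (by positivity)]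
      linarith [hale δ s]
    · refine Eventually.of_forall fun s => ?_
      rcases eq_or_ne s x with rfl | hsx
      · simp [ha, logRemainder, zero_pow (Nat.one_le_iff_ne_zero.1 hn)]
      have hpos : 0 < |s - x| := abs_pos.2 (sub_ne_zero.2 hsx)
      have hub : Tendsto (fun δ : ℝ => 2 * |δ| / |s - x| ^ (n + 1)) (𝓝[≠] 0) (𝓝 0) := by
        refine Tendsto.mono_left ?_ nhdsWithin_le_nhds
        have : Continuous fun δ : ℝ => 2 * |δ| / |s - x| ^ (n + 1) := by fun_prop
        simpa using this.tendsto 0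
      refine squeeze_zero' (Eventually.of_forall fun δ => div_nonneg (ha0 δ s) (by positivity))
        ?_ hub
      have hsmall : ∀ᶠ δ : ℝ in 𝓝[≠] 0, |δ| < |s - x| / 2 := by
        refine nhdsWithin_le_nhds ?_
        filter_upwards [Metric.ball_mem_nhds (0 : ℝ) (half_pos hpos)] with δ hδ
        simpa using hδ
      filter_upwards [hsmall, self_mem_nhdsWithin] with δ hδ hδ0
      have hδpos : 0 < |δ| := abs_pos.2 hδ0
      have h1 : |δ / (s - x)| ≤ 1 / 2 := by
        rw [abs_div, div_le_iff₀ hpos]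
        linarith
      have h2 : a δ s ≤ 2 * |δ / (s - x)| ^ (n + 1) :=
        (min_le_left _ _).trans (abs_logRemainder_le_of_abs_le_half n h1)
      rw [div_le_iff₀ (by positivity)]
      refine h2.trans_eq ?_
      rw [abs_div, div_pow, pow_succ |δ|]
      ring
  have hlim2 : Tendsto (fun δ : ℝ => (∫ s, a δ s / |δ| ^ n ∂μ) + |K| * √|δ|) (𝓝[≠] 0) (𝓝 0) := by
    have h2 : Tendsto (fun δ : ℝ => |K| * √|δ|) (𝓝[≠] 0) (𝓝 0) := by
      refine Tendsto.mono_left ?_ nhdsWithin_le_nhds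
      have : Continuous fun δ : ℝ => |K| * √|δ| := by fun_prop
      simpa using this.tendsto 0
    simpa using hlim.add h2
  rw [Asymptotics.isLittleO_iff_tendsto' (by
    filter_upwards [self_mem_nhdsWithin] with δ hδ0 h0
    exact absurd h0 (pow_ne_zero n hδ0))]
  refine squeeze_zero_norm' ?_ hlim2
  filter_upwards [hgi, hRi, self_mem_nhdsWithin] with δ hδ hδR hδ0
  have hδpos : 0 < |δ| ^ n := pow_pos (abs_pos.2 hδ0) n
  rw [norm_div, norm_pow, Real.norm_eq_abs δ, div_le_iff₀ hδpos, integral_div, add_mul,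
    div_mul_cancel₀ _ hδpos.ne']
  calc ‖∫ s, logRemainder n (δ / (s - x)) ∂μ‖ ≤ ∫ s, ‖logRemainder n (δ / (s - x))‖ ∂μ :=
        norm_integral_le_integral_norm _
    _ ≤ ∫ s, (a δ s + g δ s) ∂μ :=
        integral_mono hδR.norm ((hai δ).add hδ.1) fun s => hRle δ s
    _ = (∫ s, a δ s ∂μ) + ∫ s, g δ s ∂μ := integral_add (hai δ) hδ.1
    _ ≤ _ := by linarith [hδ.2]

end DensityBound

/-! ### Singular points satisfy the density bound -/

lemma HasDensityNear.exists_densityBound {μ : Measure ℝ} {ψ : ℝ → ℝ} {x : ℝ}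
    (h : HasDensityNear μ ψ x) {n : ℕ} {C : ℝ} (hψ : ∀ᶠ s in 𝓝 x, ψ s ≤ C * |s - x| ^ n) :
    ∃ r, 0 < r ∧ DensityBound μ x n r C := by
  obtain ⟨ε, hε, hdens⟩ := h
  obtain ⟨η, hη, hball⟩ := Metric.eventually_nhds_iff.1 hψ
  have hsub : Set.Ioo (x - min ε η) (x + min ε η) ⊆ Set.Ioo (x - ε) (x + ε) :=
    Set.Ioo_subset_Ioo (by linarith [min_le_left ε η]) (by linarith [min_le_left ε η])
  refine ⟨min ε η, lt_min hε hη, ?_⟩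
  rw [DensityBound, ← Measure.restrict_restrict_of_subset hsub, hdens,
    restrict_withDensity measurableSet_Ioo, Measure.restrict_restrict_of_subset hsub]
  refine withDensity_mono ?_
  filter_upwards [ae_restrict_mem measurableSet_Ioo] with s hs
  refine ENNReal.ofReal_le_ofReal (hball ?_)
  rw [Real.dist_eq, abs_lt]
  constructor <;> linarith [hs.1, hs.2, min_le_right ε η]

lemma eventually_abs_le_two {h : ℝ → ℝ} {x : ℝ} (hh : AnalyticAt ℝ h x) (h1 : h x = 1) :
    ∀ᶠ s in 𝓝 x, |h s| ≤ 2 := by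
  have : Tendsto (fun s => |h s|) (𝓝 x) (𝓝 1) := by
    simpa [h1] using hh.continuousAt.abs.tendsto
  exact (this.eventually_lt_const (by norm_num : (1 : ℝ) < 2)).mono fun _ => le_of_lt

lemma rpow_two_mul_add_half_le {u : ℝ} (h0 : 0 ≤ u) (h1 : u ≤ 1) (k : ℕ) :
    u ^ (2 * (k : ℝ) + 1 / 2) ≤ u ^ (2 * k) := by
  have h := Real.rpow_le_rpow_of_exponent_ge_of_imp (x := u) (y := 2 * (k : ℝ) + 1 / 2)
    (z := 2 * (k : ℝ)) h0 h1 (by linarith) (by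
      intro _ h
      have : (0 : ℝ) ≤ k := Nat.cast_nonneg k
      linarith)
  refine h.trans_eq ?_
  exact_mod_cast Real.rpow_natCast u (2 * k)

lemma eventually_abs_sub_le_one (x : ℝ) : ∀ᶠ s in 𝓝 x, |s - x| ≤ 1 := by
  filter_upwards [Metric.closedBall_mem_nhds x one_pos] with s hs
  simpa [Real.dist_eq] using hs

lemma IsSingularInteriorPoint.exists_densityBound {μ : Measure ℝ} {k : ℕ} {x : ℝ}
    (hx : IsSingularInteriorPoint μ k x) :
    ∃ r C, 0 < r ∧ DensityBound μ x (2 * k) r C := by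
  obtain ⟨-, -, c₀, h, hc₀, hh, h1, hdens⟩ := hx
  obtain ⟨r, hr, hb⟩ := hdens.exists_densityBound (n := 2 * k) (C := c₀ ^ (2 * k + 1) * 2) (by
    filter_upwards [eventually_abs_le_two hh h1] with s hs
    refine (le_abs_self _).trans ?_
    rw [abs_mul, abs_mul, abs_pow (s - x), abs_of_nonneg (by positivity : 0 ≤ c₀ ^ (2 * k + 1)),
      mul_right_comm]
    gcongr)
  exact ⟨r, _, hr, hb⟩

lemma IsSingularEdgePoint.exists_densityBound {μ : Measure ℝ} {k : ℕ} {x : ℝ}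
    (hx : IsSingularEdgePoint μ k x) :
    ∃ r C, 0 < r ∧ DensityBound μ x (2 * k) r C := by
  -- Serves both edges, with `u = x - s` or `u = s - x`; the extra half power is discarded since `u
  -- ≤ 1`.
  have key : ∀ (c : ℝ) (h : ℝ → ℝ) (u s : ℝ), 0 < c → |h s| ≤ 2 → 0 ≤ u → u ≤ 1 → u = |s - x| →
      c * u ^ (2 * (k : ℝ) + 1 / 2) * h s ≤ c * 2 * |s - x| ^ (2 * k) := by
    intro c h u s hc hs h0 h1 hu
    refine (le_abs_self _).trans ?_
    rw [abs_mul, abs_mul, abs_of_pos hc, abs_of_nonneg (Real.rpow_nonneg h0 _), ← hu,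
      mul_right_comm]
    have := rpow_two_mul_add_half_le h0 h1 k
    gcongr
  rcases hx with ⟨-, -, c₀, h, hc₀, hh, h1, hdens⟩ | ⟨-, -, c₀, h, hc₀, hh, h1, hdens⟩
  all_goals
    obtain ⟨r, hr, hb⟩ := hdens.exists_densityBound (n := 2 * k)
      (C := c₀ ^ (2 * (k : ℝ) + 3 / 2) * 2) (by
        filter_upwards [eventually_abs_le_two hh h1, eventually_abs_sub_le_one x] with s hs hsx
        split_ifs with hle
        · refine key _ h _ s (Real.rpow_pos_of_pos hc₀ _) hs (by linarith)
            (by linarith [(abs_le.1 hsx).1, (abs_le.1 hsx).2]) ?_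
          first
          | rw [abs_of_nonneg (sub_nonneg.2 hle)]
          | rw [abs_sub_comm, abs_of_nonneg (sub_nonneg.2 hle)]
        · positivity)
    exact ⟨r, _, hr, hb⟩

/-! ### Comparison of the two expansions -/

/-- The limit at 0 kills the constant term; dividing by `δ` lowers the degree. A general filter is
needed because the expansion is available only along a set accumulating at 0. -/
lemma coeff_eq_zero_of_isLittleO {F : Filter ℝ} [F.NeBot] (hF : F ≤ 𝓝[≠] 0) (n : ℕ) (a : ℕ → ℝ)
    (h : (fun δ : ℝ => ∑ j ∈ Finset.range (n + 1), a j * δ ^ j) =o[F] fun δ => δ ^ n) :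
    ∀ j ≤ n, a j = 0 := by
  have hF0 : Tendsto (fun δ : ℝ => δ) F (𝓝 0) := hF.trans nhdsWithin_le_nhds
  have hne : ∀ᶠ δ : ℝ in F, δ ≠ 0 := hF self_mem_nhdsWithin
  induction n generalizing a with
  | zero =>
    intro j hj
    obtain rfl : j = 0 := by omega
    simp only [zero_add, Finset.range_one, Finset.sum_singleton, pow_zero, mul_one] at h
    exact tendsto_nhds_unique tendsto_const_nhds ((Asymptotics.isLittleO_one_iff ℝ).1 h)
  | succ n ih =>
    have hzero : a 0 = 0 := by
      have h1 : Tendsto (fun δ : ℝ => ∑ j ∈ Finset.range (n + 1 + 1), a j * δ ^ j) F (𝓝 0) := by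
        refine h.trans_tendsto ?_
        simpa using hF0.pow (n + 1)
      have h2 : Tendsto (fun δ : ℝ => ∑ j ∈ Finset.range (n + 1 + 1), a j * δ ^ j) F (𝓝 (a 0)) := by
        have hc : Continuous fun δ : ℝ => ∑ j ∈ Finset.range (n + 1 + 1), a j * δ ^ j := by
          fun_prop
        have hval : ∑ j ∈ Finset.range (n + 1 + 1), a j * (0 : ℝ) ^ j = a 0 := by
          rw [Finset.sum_range_succ']
          simp
        exact hval ▸ (hc.tendsto 0).comp hF0
      exact tendsto_nhds_unique h2 h1
    have hshift : ∀ j ≤ n, a (j + 1) = 0 := by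
      refine ih (fun j => a (j + 1)) ?_
      rw [Asymptotics.isLittleO_iff] at h ⊢
      intro c hc
      filter_upwards [h hc, hne] with δ hδ hδ0
      rw [Finset.sum_range_succ', hzero] at hδ
      have e : ∑ j ∈ Finset.range (n + 1), a (j + 1) * δ ^ (j + 1) =
          δ * ∑ j ∈ Finset.range (n + 1), a (j + 1) * δ ^ j := by
        rw [Finset.mul_sum]
        exact Finset.sum_congr rfl fun j _ => by ring
      rw [zero_mul, add_zero, e, pow_succ', norm_mul, norm_mul, mul_left_comm] at hδ
      exact le_of_mul_le_mul_left hδ (norm_pos_iff.2 hδ0)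
    intro j hj
    rcases j with _ | j
    · exact hzero
    · exact hshift j (by omega)

/-- Rests on the factorization `x + δ - t = (x - t)(1 - δ/(t - x))`. -/
lemma realKernel_add_eq (V : ℝ → ℝ) (n : ℕ) {x δ t : ℝ} (h1 : t ≠ x) (h2 : t ≠ x + δ) :
    realKernel V (x + δ) t = realKernel V x t + (V (x + δ) - V x) / 2 -
      logRemainder n (δ / (t - x)) +
        ∑ i ∈ Finset.range n, δ ^ (i + 1) / ((i : ℝ) + 1) * (1 / (t - x) ^ (i + 1)) := by
  have hx : t - x ≠ 0 := sub_ne_zero.2 h1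
  have hfac : x + δ - t = (x - t) * (1 - δ / (t - x)) := by
    field_simp
    ring
  have hne : x + δ - t ≠ 0 := sub_ne_zero.2 h2.symm
  have hne' : 1 - δ / (t - x) ≠ 0 := fun h => hne (by rw [hfac, h, mul_zero])
  have hlog : Real.log (x + δ - t) = Real.log (x - t) + Real.log (1 - δ / (t - x)) := by
    rw [hfac, Real.log_mul (sub_ne_zero.2 h1.symm) hne']
  have hsum : ∑ i ∈ Finset.range n, (δ / (t - x)) ^ (i + 1) / ((i : ℝ) + 1) =
      ∑ i ∈ Finset.range n, δ ^ (i + 1) / ((i : ℝ) + 1) * (1 / (t - x) ^ (i + 1)) :=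
    Finset.sum_congr rfl fun i _ => by rw [div_pow]; ring
  rw [realKernel, realKernel, logRemainder, hlog, hsum]
  ring

lemma DensityBound.integral_realKernel_add {V : ℝ → ℝ} {μ : Measure ℝ} [IsProbabilityMeasure μ]
    {x : ℝ} {n : ℕ} {r C : ℝ} (h : DensityBound μ x n r C) {δ : ℝ} (hδ : |δ| < r)
    (hR : Integrable (fun s => logRemainder n (δ / (s - x))) μ)
    (hK : Integrable (fun t => realKernel V (x + δ) t) μ) :
    ∫ t, realKernel V (x + δ) t ∂μ = ∫ t, realKernel V x t ∂μ + (V (x + δ) - V x) / 2 -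
      ∫ s, logRemainder n (δ / (s - x)) ∂μ +
        ∑ i ∈ Finset.range n, δ ^ (i + 1) / ((i : ℝ) + 1) * ∫ s, 1 / (s - x) ^ (i + 1) ∂μ := by
  have hr : 0 < r := (abs_nonneg δ).trans_lt hδ
  have hδ' := abs_lt.1 hδ
  have hae : ∀ᵐ t ∂μ, t ≠ x ∧ t ≠ x + δ := by
    have h1 : ∀ᵐ t ∂μ, t ≠ x := by
      rw [ae_iff]
      simpa using h.measure_singleton (y := x) ⟨by linarith, by linarith⟩
    have h2 : ∀ᵐ t ∂μ, t ≠ x + δ := by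
      rw [ae_iff]
      simpa using h.measure_singleton (y := x + δ) ⟨by linarith, by linarith⟩
    exact h1.and h2
  have hSi : ∀ i ∈ Finset.range n,
      Integrable (fun t => δ ^ (i + 1) / ((i : ℝ) + 1) * (1 / (t - x) ^ (i + 1))) μ :=
    fun i hi => (h.integrable_inv_pow hr (Finset.mem_range.1 hi)).const_mul _
  have hS := integrable_finsetSum _ hSi
  -- The Euler–Lagrange equation may fail at `x` itself, so integrability there is transferred from
  -- `x + δ`.
  have hKx : Integrable (fun t => realKernel V x t) μ := by
    refine (((hK.sub (integrable_const ((V (x + δ) - V x) / 2))).add hR).sub hS).congr ?_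
    filter_upwards [hae] with t ht
    simp only [Pi.add_apply, Pi.sub_apply]
    rw [realKernel_add_eq V n ht.1 ht.2]
    ring
  have hc : Integrable (fun _ : ℝ => (V (x + δ) - V x) / 2) μ := integrable_const _
  rw [integral_congr_ae (hae.mono fun t ht => realKernel_add_eq V n ht.1 ht.2),
    integral_add (f := fun t => realKernel V x t + (V (x + δ) - V x) / 2 -
      logRemainder n (δ / (t - x))) ((hKx.add hc).sub hR) hS,
    integral_sub (f := fun t => realKernel V x t + (V (x + δ) - V x) / 2) (hKx.add hc) hR,
    integral_add hKx hc, integral_finsetSum _ hSi]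
  simp only [integral_const_mul, integral_const, probReal_univ, one_smul]

/-- Every ball about `x` has positive mass and `{x}` has none, so a property valid almost everywhere
holds at points other than `x` arbitrarily close to it. -/
lemma frequently_of_mem_support {μ : Measure ℝ} {x : ℝ} (hx : x ∈ μ.support) (h0 : μ {x} = 0)
    {P : ℝ → Prop} (hP : ∀ᵐ s ∂μ, P s) : ∃ᶠ δ : ℝ in 𝓝[≠] 0, P (x + δ) := by
  intro hnot
  rw [eventually_nhdsWithin_iff, Metric.eventually_nhds_iff] at hnot
  obtain ⟨η, hη, hball⟩ := hnot
  have hpos : 0 < μ (Metric.ball x η) :=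
    (Measure.mem_support_iff_forall x).1 hx _ (Metric.ball_mem_nhds x hη)
  refine hpos.ne' (measure_mono_null (t := {x} ∪ {s | ¬P s}) (fun s hs => ?_)
    (measure_union_null h0 (ae_iff.1 hP)))
  rcases eq_or_ne s x with rfl | hsx
  · exact Or.inl rfl
  · refine Or.inr ?_
    have := hball (y := s - x) (by simpa [Real.dist_eq] using hs) (sub_ne_zero.2 hsx)
    simpa using this

theorem IsEquilibriumMeasure.iteratedDeriv_eq {V : ℝ → ℝ} (hV : IsAdmissible V) {μ : Measure ℝ}
    (hμ : IsEquilibriumMeasure V μ) {x : ℝ} (hx : x ∈ μ.support) {n : ℕ} {r C : ℝ} (hr : 0 < r)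
    (h : DensityBound μ x n r C) {l : ℕ} (hl : 1 ≤ l) (hln : l ≤ n) :
    iteratedDeriv l V x = -2 * ((l - 1).factorial : ℝ) * ∫ s, 1 / (s - x) ^ l ∂μ := by
  have := hμ.isProbability
  obtain ⟨c, hc⟩ := hμ.eulerLagrange hV
  have h0 : μ {x} = 0 := h.measure_singleton ⟨by linarith, by linarith⟩
  obtain ⟨hRi, hRo⟩ := h.eventually_integrable_and_tendsto hr (hl.trans hln)
  set G : Set ℝ := {δ | Integrable (fun t => realKernel V (x + δ) t) μ ∧
    ∫ t, realKernel V (x + δ) t ∂μ = c} with hG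
  set F : Filter ℝ := 𝓝[≠] 0 ⊓ 𝓟 G with hF
  have hFne : F.NeBot := frequently_mem_iff_neBot.1 (frequently_of_mem_support hx h0 hc)
  have hFle : F ≤ 𝓝[≠] 0 := inf_le_left
  have hsmall : ∀ᶠ δ : ℝ in 𝓝[≠] 0, |δ| < r := by
    refine nhdsWithin_le_nhds ?_
    filter_upwards [Metric.ball_mem_nhds (0 : ℝ) hr] with δ hδ
    simpa using hδ
  set m : ℕ → ℝ := fun j => ∫ s, 1 / (s - x) ^ j ∂μ with hm
  set c₀ := ∫ t, realKernel V x t ∂μ with hc₀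
  have hEL : ∀ᶠ δ in F, V (x + δ) - V x = 2 * (∫ s, logRemainder n (δ / (s - x)) ∂μ) +
      2 * (c - c₀) - ∑ i ∈ Finset.range n, 2 * m (i + 1) / ((i : ℝ) + 1) * δ ^ (i + 1) := by
    filter_upwards [hFle hsmall, hFle hRi, mem_inf_of_right (mem_principal_self G)] with δ h1 h2 h3
    have e := h.integral_realKernel_add h1 h2 h3.1
    have e2 : ∑ i ∈ Finset.range n, 2 * m (i + 1) / ((i : ℝ) + 1) * δ ^ (i + 1) =
        2 * ∑ i ∈ Finset.range n, δ ^ (i + 1) / ((i : ℝ) + 1) * m (i + 1) := by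
      rw [Finset.mul_sum]
      exact Finset.sum_congr rfl fun i _ => by ring
    rw [h3.2] at e
    rw [e2]
    linarith
  have hT : (fun δ : ℝ => V (x + δ) -
      ∑ j ∈ Finset.range (n + 1), iteratedDeriv j V x / (j.factorial : ℝ) * δ ^ j) =o[𝓝 0]
      fun δ => δ ^ n := by
    have hcd : ContDiff ℝ n V := by
      rw [← contDiffOn_univ]
      exact hV.analytic.contDiffOn uniqueDiffOn_univ
    have ht : Tendsto (fun δ : ℝ => x + δ) (𝓝 0) (𝓝 x) := by
      have : Continuous fun δ : ℝ => x + δ := by fun_prop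
      simpa using this.tendsto 0
    have := (taylor_isLittleO_univ (x₀ := x) hcd).comp_tendsto ht
    refine this.congr (fun δ => ?_) (fun δ => by simp)
    simp only [Function.comp_apply, taylor_within_apply, iteratedDerivWithin_univ,
      add_sub_cancel_left, smul_eq_mul]
    congr 1
    exact Finset.sum_congr rfl fun j _ => by ring
  -- Coefficients of the difference of the two expansions. The constant `c₀` at `x` is not known
  -- beforehand to equal `c`, so `c - c₀` is carried as the term of degree 0.
  set a : ℕ → ℝ := fun j => if j = 0 then -(2 * (c - c₀)) else
    iteratedDeriv j V x / (j.factorial : ℝ) + 2 * m j / j with ha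
  have hao : (fun δ : ℝ => ∑ j ∈ Finset.range (n + 1), a j * δ ^ j) =o[F] fun δ => δ ^ n := by
    have h1 := ((hRo.mono hFle).const_mul_left 2).sub
      (hT.mono (hFle.trans nhdsWithin_le_nhds))
    refine h1.congr' ?_ EventuallyEq.rfl
    filter_upwards [hEL] with δ hδ
    rw [Finset.sum_range_succ', Finset.sum_range_succ']
    have e : ∑ i ∈ Finset.range n, a (i + 1) * δ ^ (i + 1) =
        ∑ i ∈ Finset.range n, iteratedDeriv (i + 1) V x / ((i + 1).factorial : ℝ) * δ ^ (i + 1) +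
          ∑ i ∈ Finset.range n, 2 * m (i + 1) / ((i : ℝ) + 1) * δ ^ (i + 1) := by
      rw [← Finset.sum_add_distrib]
      refine Finset.sum_congr rfl fun i _ => ?_
      simp only [ha, Nat.add_eq_zero_iff, one_ne_zero, and_false, if_false]
      push_cast
      ring
    rw [e]
    simp only [ha, if_true, iteratedDeriv_zero, Nat.factorial_zero, Nat.cast_one, div_one,
      pow_zero, mul_one]
    linarith
  have hal := coeff_eq_zero_of_isLittleO hFle n a hao l hln
  have hl0 : l ≠ 0 := by omega
  have hlR : (l : ℝ) ≠ 0 := Nat.cast_ne_zero.2 hl0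
  simp only [ha, hl0, if_false] at hal
  have hfac : (l.factorial : ℝ) = l * ((l - 1).factorial : ℝ) := by
    exact_mod_cast (Nat.mul_factorial_pred hl0).symm
  have hfne : ((l - 1).factorial : ℝ) ≠ 0 := Nat.cast_ne_zero.2 (Nat.factorial_ne_zero _)
  rw [hfac] at hal
  field_simp at hal
  linarith

end ExternalField

/-! ### The derivative formulas and the critical value -/

theorem lemma1 (V : ℝ → ℝ) (hV : ExternalField.IsAdmissible V)
    (μ₀ : Measure ℝ) (hμ₀ : ExternalField.IsEquilibriumMeasure V μ₀)
    (k : ℕ) (x : ℝ)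
    (hx : ExternalField.IsSingularInteriorPoint μ₀ k x ∨
      ExternalField.IsSingularEdgePoint μ₀ k x) :
    (∀ l : ℕ, 1 ≤ l → l ≤ 2 * k →
      Integrable (fun s : ℝ => 1 / (s - x) ^ l) μ₀ ∧
      iteratedDeriv l V x =
        -2 * ((l - 1).factorial : ℝ) * ∫ s, 1 / (s - x) ^ l ∂μ₀) ∧
    0 < ExternalField.tauCrit μ₀ x ∧
    iteratedDeriv 2 V x < 0 ∧
    ExternalField.tauCrit μ₀ x = -2 / iteratedDeriv 2 V x ∧
    ∀ τ : ℝ, ExternalField.shiftedPoint μ₀ x τ = x + τ / 2 * deriv V x := by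
  have := hμ₀.isProbability
  have hk : 1 ≤ k := by
    rcases hx with hx | hx | hx <;> exact hx.1
  have hsupp : x ∈ μ₀.support := by
    rcases hx with hx | hx | hx
    · exact interior_subset hx.2.1
    · exact hx.2.1
    · exact hx.2.1
  obtain ⟨r, C, hr, hb⟩ : ∃ r C, 0 < r ∧ ExternalField.DensityBound μ₀ x (2 * k) r C :=
    hx.elim (fun h => h.exists_densityBound) fun h => h.exists_densityBound
  have main : ∀ l : ℕ, 1 ≤ l → l ≤ 2 * k → Integrable (fun s : ℝ => 1 / (s - x) ^ l) μ₀ ∧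
      iteratedDeriv l V x = -2 * ((l - 1).factorial : ℝ) * ∫ s, 1 / (s - x) ^ l ∂μ₀ :=
    fun l h1 h2 => ⟨hb.integrable_inv_pow hr h2, hμ₀.iteratedDeriv_eq hV hsupp hr hb h1 h2⟩
  obtain ⟨hi2, hd2⟩ := main 2 (by norm_num) (by omega)
  obtain ⟨-, hd1⟩ := main 1 le_rfl (by omega)
  -- The integrand vanishes only at `s = x` (where `1 / 0 = 0`), and `x` is not an atom.
  have hpos : 0 < ∫ s, 1 / (s - x) ^ 2 ∂μ₀ := by
    rw [integral_pos_iff_support_of_nonneg (fun s => by positivity) hi2]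
    have hs : Function.support (fun s : ℝ => 1 / (s - x) ^ 2) = {x}ᶜ := by
      ext s
      simp [sub_eq_zero]
    rw [hs, (prob_compl_eq_one_iff (measurableSet_singleton x)).2
      (hb.measure_singleton ⟨by linarith, by linarith⟩)]
    exact one_pos
  have htau : ExternalField.tauCrit μ₀ x = (∫ s, 1 / (s - x) ^ 2 ∂μ₀)⁻¹ := by
    rw [ExternalField.tauCrit]
    congr 2
    ext s
    rw [sub_sq_comm]
  have hm1 : ∫ s, 1 / (x - s) ∂μ₀ = -∫ s, 1 / (s - x) ∂μ₀ := by
    rw [← integral_neg]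
    congr 1
    ext s
    rw [← neg_sub s x, div_neg]
  simp only [Nat.add_one_sub_one, Nat.factorial_one, Nat.cast_one, mul_one] at hd2
  simp only [iteratedDeriv_one, le_refl, tsub_eq_zero_of_le, Nat.factorial_zero, Nat.cast_one,
    mul_one, pow_one] at hd1
  refine ⟨main, ?_, ?_, ?_, fun τ => ?_⟩
  · rw [htau]
    exact inv_pos.2 hpos
  · rw [hd2]
    linarith
  · rw [htau, hd2]
    field_simp
  · rw [ExternalField.shiftedPoint, hm1, hd1]
    ring
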